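/- Let $\alpha\in\mathbb N_0=\{0,1,2,\dots\}$ and $D=d/dx$. For $\lambda\ge 0$, $M\ge 0$ and $0\le x<\infty$ put $$J_\lambda^{\alpha}(x)={}_0F_1\!\big(-;\alpha+1;-\tfrac14(\lambda x)^2\big)=\sum_{k=0}^\infty\frac{\big(-\tfrac14(\lambda x)^2\big)^k}{(\alpha+1)_k\,k!},\qquad K_\lambda^{\alpha}(x)=-\frac{(\lambda/2)^{2\alpha+4}}{(\alpha+1)\,(\alpha+2)!}\,x^2J_\lambda^{\alpha+2}(x),$$ where $(b)_k=b(b+1)\cdots(b+k-1)$, and define the Bessel-type functions by $J_\lambda^{\alpha,M}=J_\lambda^{\alpha}+M\,K_\lambda^{\alpha}$. For real-valued functions $y$ and $x>0$ put $$\widetilde L_{2}^{\alpha}y(x)=x^{-2\alpha-1}D\big[x^{2\alpha+1}Dy(x)\big],\qquad \widetilde L_{2\alpha+4}^{\alpha}y(x)=(-1)^{\alpha+1}x^2\,(x^{-1}D)^{2\alpha+4}\big[x^{2\alpha+2}y(x)\big].$$ **Theorem 5.1.** (i) The two operators have the alternative representations $$\widetilde L_{2}^{\alpha}y(x)=\Big[D^2+\frac{2\alpha+1}{x}D\Big]y(x)\quad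 (y\in C^{2}(0,\infty),\ x>0),$$ $$\widetilde L_{2\alpha+4}^{\alpha}y(x)=(-1)^{\alpha+1}\Big[D^2+\frac{2\alpha+1}{x}D-\frac{4\alpha+4}{x^2}\Big]^{\alpha+2}y(x)\quad (y\in C^{2\alpha+4}(0,\infty),\ x>0).$$ For all $M\ge 0$ and $\lambda\ge 0$, the function $y=J_\lambda^{\alpha,M}$ is infinitely differentiable on $[0,\infty)$ and satisfies $$\Big\{\big[\widetilde L_{2}^{\alpha}+\lambda^2\big]+\frac{M}{2^{2\alpha+2}(\alpha+2)!}\big[\widetilde L_{2\alpha+4}^{\alpha}+\lambda^{2\alpha+4}\big]\Big\}\,y(x)=0,\qquad 0\le x<\infty .$$ (ii) For all $\lambda\ge 0$, the function $K_\lambda^{\alpha}$ is infinitely differentiable on $[0,\infty)$ and satisfies $$\big[\widetilde L_{2\alpha+4}^{\alpha}+\lambda^{2\alpha+4}\big]K_\lambda^{\alpha}(x)=0,\qquad 0\le x<\infty .$$ If $\lambda>0$, then $K_\lambda^{\alpha}$ does not vanish identically on $(0,\infty)$, so it is an eigenfunction of $\widetilde L_{2\alpha+4}^{\alpha}$ with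 eigenvalue $-\lambda^{2\alpha+4}$. In both equations, the values at $x=0$ of $\widetilde L_{2}^{\alpha}y$ and $\widetilde L_{2\alpha+4}^{\alpha}y$ are the limits as $x\to0^+$; the existence of these limits is part of the assertion. -/

import Mathlib

open Set Filter Topology
open scoped ContDiff

noncomputable section

/-- The hypergeometric series `₀F₁(-; b; z) = ∑ₖ z ^ k / ((b)ₖ k!)`, where `(b)ₖ` is the
rising factorial. It converges for every `z` if `b` is not a nonpositive integer. -/
def hypergeometricZeroFOne (b z : ℝ) : ℝ :=
  ∑' k : ℕ, z ^ k / ((ascPochhammer ℝ k).eval b * (Nat.factorial k : ℝ))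

/-- The normalized classical Bessel function `J_lam^α(x) = ₀F₁(-; α + 1; -(lam x)² / 4)`. -/
def besselJ (α : ℕ) (lam x : ℝ) : ℝ :=
  hypergeometricZeroFOne ((α : ℝ) + 1) (-(1 / 4) * (lam * x) ^ 2)

/-- `k_lam^α = (lam / 2) ^ (2 α + 4) / ((α + 1) (α + 2)!)`. -/
def besselCoeff (α : ℕ) (lam : ℝ) : ℝ :=
  (lam / 2) ^ (2 * α + 4) / (((α : ℝ) + 1) * (Nat.factorial (α + 2) : ℝ))

/-- The second component `K_lam^α(x) = - k_lam^α x² J_lam^(α+2)(x)`. -/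
def besselK (α : ℕ) (lam x : ℝ) : ℝ :=
  -besselCoeff α lam * x ^ 2 * besselJ (α + 2) lam x

/-- The Bessel-type function `J_lam^(α,M) = J_lam^α + M K_lam^α`. -/
def besselTypeJ (α : ℕ) (M lam x : ℝ) : ℝ :=
  besselJ α lam x + M * besselK α lam x

/-- The operator `y ↦ x⁻¹ D y`. -/
def invXDeriv (y : ℝ → ℝ) : ℝ → ℝ := fun x => x⁻¹ * deriv y x

/-- The Bessel operator `y ↦ x ^ (-2 α - 1) D [x ^ (2 α + 1) D y]`. -/
def besselOpTwo (α : ℕ) (y : ℝ → ℝ) : ℝ → ℝ := fun x =>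
  (x ^ (2 * α + 1))⁻¹ * deriv (fun t => t ^ (2 * α + 1) * deriv y t) x

/-- The operator `y ↦ (-1) ^ (α + 1) x² (x⁻¹ D) ^ (2 α + 4) [x ^ (2 α + 2) y]`
of order `2 α + 4`. -/
def besselOpHigher (α : ℕ) (y : ℝ → ℝ) : ℝ → ℝ := fun x =>
  (-1) ^ (α + 1) * x ^ 2 * (invXDeriv^[2 * α + 4] (fun t => t ^ (2 * α + 2) * y t)) x

/-- The second-order factor `y ↦ [D² + ((2 α + 1) / x) D - (4 α + 4) / x²] y`. -/
def besselFactor (α : ℕ) (y : ℝ → ℝ) : ℝ → ℝ := fun x =>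
  deriv (deriv y) x + (2 * (α : ℝ) + 1) / x * deriv y x - (4 * (α : ℝ) + 4) / x ^ 2 * y x

end

/-! ### The operator `x⁻¹ D` on the positive half-line -/

/-! Write δ for `x⁻¹ D`, which is the derivative in x²/2. Up to constants, the Bessel functions are
E_n(μx²), where E_n is `besselEntire n` and μ = -λ²/4. Since E_n' = E_{n+1}, δ raises n; the
recurrence E_n(z) = z E_{n+2}(z) + (n+1) E_{n+1}(z), which is the Bessel equation, makes δ lower n
in x^{2n} E_n(μx²).

These two rules evaluate both operators on A E_α + B x² E_{α+2}. The second-order operator plus λ²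
kills the A part and the higher one plus λ^{2α+4} kills the B part. Each leaves a multiple of the
same E_{α+2}, and the coefficients cancel. The results are continuous on the whole line, which gives
the limits at 0.

The factorized form of the higher operator is an induction on the power of the factor, using only
the product rule for δ. -/

theorem invXDeriv_congr {f g : ℝ → ℝ} (h : EqOn f g (Ioi 0)) :
    EqOn (invXDeriv f) (invXDeriv g) (Ioi 0) := fun x hx => by
  have : f =ᶠ[𝓝 x] g := h.eventuallyEq_of_mem (Ioi_mem_nhds hx)
  simp only [invXDeriv, this.deriv_eq]

theorem invXDeriv_iterate_congr {f g : ℝ → ℝ} (h : EqOn f g (Ioi 0)) (k : ℕ) :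
    EqOn (invXDeriv^[k] f) (invXDeriv^[k] g) (Ioi 0) := by
  induction k with
  | zero => exact h
  | succ k ih => simpa only [Function.iterate_succ_apply'] using invXDeriv_congr ih

theorem ContDiffOn.differentiableAt_of_pos {f : ℝ → ℝ} {n : ℕ}
    (hf : ContDiffOn ℝ ((n + 1 : ℕ) : ℕ∞) f (Ioi 0)) {x : ℝ} (hx : 0 < x) :
    DifferentiableAt ℝ f x :=
  ((hf.contDiffAt (Ioi_mem_nhds hx)).differentiableAt (by simp))

theorem ContDiffOn.deriv_Ioi {f : ℝ → ℝ} {n : ℕ}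
    (hf : ContDiffOn ℝ ((n + 1 : ℕ) : ℕ∞) f (Ioi 0)) :
    ContDiffOn ℝ ((n : ℕ) : ℕ∞) (deriv f) (Ioi 0) :=
  hf.deriv_of_isOpen isOpen_Ioi (by norm_cast)

theorem ContDiffOn.invXDeriv {f : ℝ → ℝ} {n : ℕ}
    (hf : ContDiffOn ℝ ((n + 1 : ℕ) : ℕ∞) f (Ioi 0)) :
    ContDiffOn ℝ ((n : ℕ) : ℕ∞) (invXDeriv f) (Ioi 0) :=
  (contDiffOn_id.inv fun _ hx => (ne_of_gt hx)).mul hf.deriv_Ioi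

theorem ContDiffOn.invXDeriv_iterate {f : ℝ → ℝ} {n k : ℕ}
    (hf : ContDiffOn ℝ ((n + k : ℕ) : ℕ∞) f (Ioi 0)) :
    ContDiffOn ℝ ((n : ℕ) : ℕ∞) (_root_.invXDeriv^[k] f) (Ioi 0) := by
  induction k generalizing f with
  | zero => simpa using hf
  | succ k ih => exact ih (ContDiffOn.invXDeriv hf)

theorem ContDiffOn.of_le_nat {f : ℝ → ℝ} {m n : ℕ} {s : Set ℝ}
    (hf : ContDiffOn ℝ ((n : ℕ) : ℕ∞) f s) (h : m ≤ n) :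
    ContDiffOn ℝ ((m : ℕ) : ℕ∞) f s :=
  hf.of_le (by exact_mod_cast h)

theorem invXDeriv_iterate_add {f g : ℝ → ℝ} {k : ℕ}
    (hf : ContDiffOn ℝ ((k : ℕ) : ℕ∞) f (Ioi 0)) (hg : ContDiffOn ℝ ((k : ℕ) : ℕ∞) g (Ioi 0)) :
    EqOn (invXDeriv^[k] (fun x => f x + g x))
      (fun x => invXDeriv^[k] f x + invXDeriv^[k] g x) (Ioi 0) := by
  induction k generalizing f g with
  | zero => exact fun _ _ => rfl
  | succ k ih =>
    have h : EqOn (invXDeriv fun x => f x + g x) (fun x => invXDeriv f x + invXDeriv g x)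
        (Ioi 0) := fun x hx => by
      simp only [invXDeriv]
      rw [deriv_fun_add (hf.differentiableAt_of_pos hx) (hg.differentiableAt_of_pos hx), mul_add]
    exact (invXDeriv_iterate_congr h k).trans (ih hf.invXDeriv hg.invXDeriv)

theorem invXDeriv_iterate_const_mul (f : ℝ → ℝ) (c : ℝ) (k : ℕ) :
    invXDeriv^[k] (fun x => c * f x) = fun x => c * invXDeriv^[k] f x := by
  induction k generalizing f with
  | zero => rfl
  | succ k ih =>
    have h : (invXDeriv fun x => c * f x) = fun x => c * invXDeriv f x := by
      ext x
      simp only [invXDeriv, deriv_const_mul_field]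
      ring
    simp only [Function.iterate_succ_apply, h, ih]

theorem invXDeriv_pow_mul {f : ℝ → ℝ} {n : ℕ} {x : ℝ} (hf : DifferentiableAt ℝ f x) (hx : 0 < x) :
    invXDeriv (fun t => t ^ (2 * n + 2) * f t) x =
      x ^ (2 * n + 2) * invXDeriv f x + (2 * n + 2) * x ^ (2 * n) * f x := by
  have h := (hasDerivAt_pow (2 * n + 2) x).fun_mul hf.hasDerivAt
  simp only [invXDeriv, h.deriv]
  rw [show 2 * n + 2 - 1 = 2 * n + 1 by omega]
  push_cast
  field_simp
  ring

theorem invXDeriv_sq_mul {f : ℝ → ℝ} {x : ℝ} (hf : DifferentiableAt ℝ f x) (hx : 0 < x) :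
    invXDeriv (fun t => t ^ 2 * f t) x = x ^ 2 * invXDeriv f x + 2 * f x := by
  simpa using invXDeriv_pow_mul (n := 0) hf hx

/-- Leibniz rule for the derivation δ: since δ(x²) = 2 is constant, only two terms survive. -/
theorem invXDeriv_iterate_sq_mul {f : ℝ → ℝ} {k : ℕ}
    (hf : ContDiffOn ℝ ((k + 1 : ℕ) : ℕ∞) f (Ioi 0)) :
    EqOn (invXDeriv^[k + 1] (fun x => x ^ 2 * f x))
      (fun x => x ^ 2 * invXDeriv^[k + 1] f x + 2 * (k + 1) * invXDeriv^[k] f x) (Ioi 0) := by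
  induction k with
  | zero =>
    intro x hx
    simpa using invXDeriv_sq_mul (hf.differentiableAt_of_pos hx) hx
  | succ k ih =>
    intro x hx
    rw [Function.iterate_succ_apply', invXDeriv_congr (ih (hf.of_le_nat (by omega))) hx]
    have h1 : ContDiffOn ℝ ((1 : ℕ) : ℕ∞) (invXDeriv^[k + 1] f) (Ioi 0) :=
      ContDiffOn.invXDeriv_iterate (hf.of_le_nat (by omega))
    have h2 : ContDiffOn ℝ ((1 : ℕ) : ℕ∞) (invXDeriv^[k] f) (Ioi 0) :=
      ContDiffOn.invXDeriv_iterate (hf.of_le_nat (by omega))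
    have d1 := h1.differentiableAt_of_pos hx
    have h3 := invXDeriv_iterate_add (k := 1) (f := fun x => x ^ 2 * invXDeriv^[k + 1] f x)
      (g := fun x => 2 * (k + 1) * invXDeriv^[k] f x)
      ((contDiffOn_id.pow 2).mul h1) (contDiffOn_const.mul h2) hx
    have h4 := congrFun (invXDeriv_iterate_const_mul (invXDeriv^[k] f) (2 * (k + 1)) 1) x
    simp only [Function.iterate_one] at h3 h4
    rw [h3, h4, invXDeriv_sq_mul d1 hx]
    simp only [Function.iterate_succ_apply']
    push_cast
    ring

/-! ### The two operators in terms of `x⁻¹ D` -/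

theorem besselOpTwo_eq_deriv (α : ℕ) {y : ℝ → ℝ} (hy : ContDiffOn ℝ ((2 : ℕ) : ℕ∞) y (Ioi 0))
    {x : ℝ} (hx : 0 < x) :
    besselOpTwo α y x = deriv (deriv y) x + (2 * (α : ℝ) + 1) / x * deriv y x := by
  have h := (hasDerivAt_pow (2 * α + 1) x).fun_mul
    ((ContDiffOn.deriv_Ioi (n := 1) hy).differentiableAt_of_pos hx).hasDerivAt
  simp only [besselOpTwo, h.deriv]
  rw [Nat.add_sub_cancel]
  push_cast
  field_simp
  ring

theorem deriv_eq_mul_invXDeriv (y : ℝ → ℝ) : EqOn (deriv y) (fun x => x * invXDeriv y x) (Ioi 0) :=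
  fun x hx => by
    have : x ≠ 0 := ne_of_gt hx
    simp [invXDeriv, this]

theorem deriv_deriv_eq_invXDeriv {y : ℝ → ℝ} (hy : ContDiffOn ℝ ((2 : ℕ) : ℕ∞) y (Ioi 0))
    {x : ℝ} (hx : 0 < x) :
    deriv (deriv y) x = invXDeriv y x + x ^ 2 * invXDeriv (invXDeriv y) x := by
  have d := (ContDiffOn.invXDeriv (n := 1) hy).differentiableAt_of_pos hx
  rw [((deriv_eq_mul_invXDeriv y).eventuallyEq_of_mem (Ioi_mem_nhds hx)).deriv_eq,
    ((hasDerivAt_id' x).fun_mul d.hasDerivAt).deriv, deriv_eq_mul_invXDeriv _ hx]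
  ring

theorem besselOpTwo_eq_invXDeriv (α : ℕ) {y : ℝ → ℝ}
    (hy : ContDiffOn ℝ ((2 : ℕ) : ℕ∞) y (Ioi 0)) {x : ℝ} (hx : 0 < x) :
    besselOpTwo α y x =
      x ^ 2 * invXDeriv (invXDeriv y) x + (2 * (α : ℝ) + 2) * invXDeriv y x := by
  rw [besselOpTwo_eq_deriv α hy hx, deriv_deriv_eq_invXDeriv hy hx, deriv_eq_mul_invXDeriv y hx]
  field_simp
  ring

theorem besselFactor_congr (α : ℕ) {f g : ℝ → ℝ} (h : EqOn f g (Ioi 0)) :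
    EqOn (besselFactor α f) (besselFactor α g) (Ioi 0) := fun x hx => by
  have h' : f =ᶠ[𝓝 x] g := h.eventuallyEq_of_mem (Ioi_mem_nhds hx)
  simp only [besselFactor, h'.deriv_eq, h'.deriv.deriv_eq, h hx]

/-- Conjugating the factor by multiplication with `x²`. -/
theorem besselFactor_sq_mul (α : ℕ) {v : ℝ → ℝ} (hv : ContDiffOn ℝ ((2 : ℕ) : ℕ∞) v (Ioi 0))
    {x : ℝ} (hx : 0 < x) :
    besselFactor α (fun t => t ^ 2 * v t) x =
      x ^ 2 * (x ^ 2 * invXDeriv (invXDeriv v) x + (2 * α + 6) * invXDeriv v x) := by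
  have hw : ContDiffOn ℝ ((2 : ℕ) : ℕ∞) (fun t => t ^ 2 * v t) (Ioi 0) :=
    (contDiffOn_id.pow 2).mul hv
  have e1 := invXDeriv_sq_mul (hv.differentiableAt_of_pos hx) hx
  have e2 := invXDeriv_iterate_sq_mul hv hx
  simp only [Function.iterate_succ_apply', Function.iterate_zero_apply] at e2
  rw [besselFactor, deriv_deriv_eq_invXDeriv hw hx, deriv_eq_mul_invXDeriv _ hx]
  simp only [e1, e2]
  field_simp
  push_cast
  ring

/-- The powers of the second-order factor, written with two blocks of `x⁻¹ D`. -/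
theorem besselFactor_iterate (α : ℕ) {y : ℝ → ℝ}
    (hy : ContDiffOn ℝ ((2 * α + 4 : ℕ) : ℕ∞) y (Ioi 0)) {j k : ℕ} (hjk : j + k = α + 2) :
    EqOn ((besselFactor α)^[k] y)
      (fun x => x ^ 2 * invXDeriv^[k] (fun t => (t ^ (2 * j))⁻¹ *
        invXDeriv^[k] (fun s => s ^ (2 * α + 2) * y s) t) x) (Ioi 0) := by
  have hy' : ContDiffOn ℝ ((2 * α + 4 : ℕ) : ℕ∞) (fun s => s ^ (2 * α + 2) * y s) (Ioi 0) :=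
    (contDiffOn_id.pow _).mul hy
  induction k generalizing j with
  | zero =>
    intro x hx
    have : x ≠ 0 := ne_of_gt hx
    obtain rfl : j = α + 2 := by omega
    simp only [Function.iterate_zero_apply]
    field_simp
    ring
  | succ k ih =>
    intro x hx
    set w := invXDeriv^[k] (fun s => s ^ (2 * α + 2) * y s) with hw
    -- By induction the k-th power is x² δ^k u; the next one requires x^{-2j} δw, with w = x^{2j+2}
    -- u.
    set u : ℝ → ℝ := fun t => (t ^ (2 * (j + 1)))⁻¹ * w t with hu
    have cw : ContDiffOn ℝ ((k + 2 : ℕ) : ℕ∞) w (Ioi 0) :=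
      ContDiffOn.invXDeriv_iterate (hy'.of_le_nat (by omega))
    have cu : ContDiffOn ℝ ((k + 2 : ℕ) : ℕ∞) u (Ioi 0) :=
      (ContDiffOn.inv (f := fun t => t ^ (2 * (j + 1))) (contDiffOn_id.pow _)
        fun t ht => pow_ne_zero _ (ne_of_gt (mem_Ioi.1 ht))).mul cw
    have cv : ContDiffOn ℝ ((2 : ℕ) : ℕ∞) (invXDeriv^[k] u) (Ioi 0) :=
      ContDiffOn.invXDeriv_iterate (cu.of_le_nat (by omega))
    have cdu : ContDiffOn ℝ ((k + 1 : ℕ) : ℕ∞) (invXDeriv u) (Ioi 0) := cu.invXDeriv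
    have key : EqOn (fun t => (t ^ (2 * j))⁻¹ * invXDeriv w t)
        (fun t => t ^ 2 * invXDeriv u t + (2 * (j + 1)) * u t) (Ioi 0) := by
      intro t ht
      have ht0 : t ≠ 0 := ne_of_gt ht
      have hwu : EqOn w (fun t => t ^ (2 * j + 2) * u t) (Ioi 0) := fun s hs => by
        have hs0 : s ≠ 0 := ne_of_gt hs
        simp only [hu, mul_add, mul_one]
        field_simp
      simp only
      rw [invXDeriv_congr hwu ht, invXDeriv_pow_mul (cu.differentiableAt_of_pos ht) ht]
      field_simp
      ring
    rw [Function.iterate_succ_apply', besselFactor_congr α (ih (j := j + 1) (by omega)) hx,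
      besselFactor_sq_mul α cv hx, Function.iterate_succ_apply' invXDeriv k
        (fun s => s ^ (2 * α + 2) * y s), ← hw]
    simp only
    rw [invXDeriv_iterate_congr key (k + 1) hx,
      invXDeriv_iterate_add (f := fun t => t ^ 2 * invXDeriv u t) ((contDiffOn_id.pow 2).mul cdu)
        (contDiffOn_const.mul (cu.of_le_nat (by omega))) hx]
    have e := congrFun (invXDeriv_iterate_const_mul u (2 * (j + 1)) (k + 1)) x
    simp only at e ⊢
    -- The coefficients of δ^{k+1} u agree because 2(j+1) + 2(k+1) = 2α + 6.
    have hα : (j : ℝ) + k + 1 = α + 2 := by exact_mod_cast hjk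
    have e2 := invXDeriv_iterate_sq_mul cdu hx
    rw [e, e2]
    simp only [← Function.iterate_succ_apply, ← Function.iterate_succ_apply' invXDeriv]
    have : (α : ℝ) = j + k - 1 := by linarith
    rw [this]
    ring

theorem besselOpHigher_eq_besselFactor (α : ℕ) {y : ℝ → ℝ}
    (hy : ContDiffOn ℝ ((2 * α + 4 : ℕ) : ℕ∞) y (Ioi 0)) {x : ℝ} (hx : 0 < x) :
    besselOpHigher α y x = (-1) ^ (α + 1) * ((besselFactor α)^[α + 2] y) x := by
  rw [besselFactor_iterate α hy (j := 0) (zero_add _) hx]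
  simp only [besselOpHigher, mul_zero, pow_zero, inv_one, one_mul, mul_assoc,
    ← Function.iterate_add_apply]
  rw [show α + 2 + (α + 2) = 2 * α + 4 by ring]

/-! ### The entire functions `∑ zᵏ / ((n + k)! k!)` -/

/-- The entire function `∑ₖ z ^ k / ((n + k)! k!)`, that is `₀F₁(-; n + 1; z) / n!`. -/
noncomputable def besselEntire (n : ℕ) (z : ℝ) : ℝ :=
  ∑' k : ℕ, z ^ k / ((Nat.factorial (n + k) : ℝ) * (Nat.factorial k : ℝ))

theorem norm_besselEntire_term_le (n k : ℕ) (z : ℝ) :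
    ‖z ^ k / ((Nat.factorial (n + k) : ℝ) * (Nat.factorial k : ℝ))‖ ≤ |z| ^ k / Nat.factorial k := by
  have h : (1 : ℝ) ≤ Nat.factorial (n + k) := by exact_mod_cast Nat.factorial_pos _
  have h' : (0 : ℝ) < Nat.factorial k := by positivity
  rw [norm_div, norm_pow, Real.norm_eq_abs, Real.norm_of_nonneg (by positivity)]
  gcongr
  nlinarith

theorem summable_besselEntire (n : ℕ) (z : ℝ) :
    Summable fun k : ℕ => z ^ k / ((Nat.factorial (n + k) : ℝ) * (Nat.factorial k : ℝ)) :=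
  .of_norm_bounded (Real.summable_pow_div_factorial |z|) fun k => norm_besselEntire_term_le n k z

theorem hasDerivAt_besselEntire (n : ℕ) (z : ℝ) :
    HasDerivAt (besselEntire n) (besselEntire (n + 1) z) z := by
  set g : ℕ → ℝ → ℝ := fun k z => z ^ k / ((Nat.factorial (n + k) : ℝ) * (Nat.factorial k : ℝ))
  set g' : ℕ → ℝ → ℝ := fun k z =>
    k * z ^ (k - 1) / ((Nat.factorial (n + k) : ℝ) * (Nat.factorial k : ℝ))
  have hsucc : ∀ k z, g' (k + 1) z =
      z ^ k / ((Nat.factorial (n + 1 + k) : ℝ) * (Nat.factorial k : ℝ)) := fun k z => by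
    simp only [g', Nat.factorial_succ k, show n + 1 + k = n + (k + 1) by ring]
    rw [Nat.add_sub_cancel]
    push_cast
    field_simp
  -- Majorant of the differentiated terms on the ball of radius |z| + 1, from (n+k)! ≥ 1; shifted by
  -- one it is an exponential series.
  set u : ℕ → ℝ := fun k => k * (|z| + 1) ^ (k - 1) / Nat.factorial k
  have hu : Summable u := by
    rw [← summable_nat_add_iff 1]
    refine (Real.summable_pow_div_factorial (|z| + 1)).congr fun k => ?_
    simp only [u, Nat.factorial_succ]
    rw [Nat.add_sub_cancel]
    push_cast
    field_simp
  have hz : z ∈ Metric.ball (0 : ℝ) (|z| + 1) := by simp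
  have key := hasDerivAt_tsum_of_isPreconnected (g := g) (g' := g') hu Metric.isOpen_ball
    (convex_ball (0 : ℝ) (|z| + 1)).isPreconnected
    (fun k y _ => (hasDerivAt_pow k y).div_const _) (fun k y hy => ?_) hz
    (summable_besselEntire n z) hz
  · have e : ∑' k, g' k z = besselEntire (n + 1) z := by
      have hs : Summable fun k => g' k z := by
        rw [← summable_nat_add_iff 1]
        exact (summable_besselEntire (n + 1) z).congr fun k => (hsucc k z).symm
      rw [hs.tsum_eq_zero_add]
      simp only [hsucc]
      simp [g', besselEntire]
    rwa [e] at key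
  · have hy' : |y| ≤ |z| + 1 := by
      rw [mem_ball_zero_iff, Real.norm_eq_abs] at hy
      exact hy.le
    have h : (1 : ℝ) ≤ Nat.factorial (n + k) := by exact_mod_cast Nat.factorial_pos _
    have h' : (0 : ℝ) < Nat.factorial k := by positivity
    simp only [g', u]
    rw [norm_div, norm_mul, norm_pow, Real.norm_eq_abs y, Real.norm_of_nonneg (Nat.cast_nonneg k),
      Real.norm_of_nonneg (by positivity)]
    gcongr
    nlinarith

theorem contDiff_besselEntire (n : ℕ) : ContDiff ℝ ∞ (besselEntire n) := by
  have hd : ∀ n, deriv (besselEntire n) = besselEntire (n + 1) := fun n =>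
    funext fun z => (hasDerivAt_besselEntire n z).deriv
  rw [contDiff_infty]
  intro m
  induction m generalizing n with
  | zero =>
    exact contDiff_zero.2 (continuous_iff_continuousAt.2 fun z =>
      (hasDerivAt_besselEntire n z).continuousAt)
  | succ m ih =>
    push_cast
    rw [contDiff_succ_iff_deriv]
    refine ⟨fun z => (hasDerivAt_besselEntire n z).differentiableAt, by simp, ?_⟩
    rw [hd]
    exact ih (n + 1)

/-- Comparing coefficients of z^{k+1} reduces this to (k+1) + (n+1) = n+k+2. -/
theorem besselEntire_recurrence (n : ℕ) (z : ℝ) :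
    besselEntire n z = z * besselEntire (n + 2) z + (n + 1) * besselEntire (n + 1) z := by
  have h0 := summable_besselEntire n z
  have h1 := (summable_besselEntire (n + 1) z).mul_left ((n : ℝ) + 1)
  have h2 := (summable_besselEntire (n + 2) z).mul_left z
  simp only [besselEntire, ← tsum_mul_left]
  rw [h0.tsum_eq_zero_add, h1.tsum_eq_zero_add, add_left_comm, ← h2.tsum_add
    ((summable_nat_add_iff 1).2 h1)]
  congr 1
  · simp [Nat.factorial_succ]
    field_simp
  · refine tsum_congr fun k => ?_
    rw [show n + 2 + k = n + k + 2 by ring, show n + (k + 1) = n + k + 1 by ring,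
      show n + 1 + (k + 1) = n + k + 2 by ring]
    simp only [Nat.factorial_succ]
    push_cast
    field_simp
    ring

theorem besselEntire_zero_pos (n : ℕ) : 0 < besselEntire n 0 := by
  rw [besselEntire, tsum_eq_single 0 (fun k hk => by simp [hk])]
  simp
  positivity

theorem besselJ_eq_besselEntire (α : ℕ) (lam x : ℝ) :
    besselJ α lam x = Nat.factorial α * besselEntire α (-(1 / 4) * lam ^ 2 * x ^ 2) := by
  rw [besselJ, hypergeometricZeroFOne, besselEntire, ← tsum_mul_left]
  refine tsum_congr fun k => ?_
  have h : (Nat.factorial (α + k) : ℝ) =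
      Nat.factorial α * (ascPochhammer ℝ k).eval ((α : ℝ) + 1) := by
    rw [← Nat.factorial_mul_ascFactorial, ← ascPochhammer_nat_eq_ascFactorial]
    push_cast [ascPochhammer_eval_cast]
    rfl
  have h0 : (ascPochhammer ℝ k).eval ((α : ℝ) + 1) ≠ 0 :=
    (ascPochhammer_pos k _ (by positivity)).ne'
  rw [h, mul_pow lam, ← mul_assoc]
  field_simp

/-! ### The functions `x ↦ besselEntire n (μ x²)` -/

theorem contDiff_besselEntire_sq (n : ℕ) (μ : ℝ) {m : ℕ∞} :
    ContDiff ℝ m fun x => besselEntire n (μ * x ^ 2) :=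
  ((contDiff_besselEntire n).comp (contDiff_const.mul (contDiff_id.pow 2))).of_le
    (by exact_mod_cast le_top)

theorem invXDeriv_besselEntire_sq (n : ℕ) (μ : ℝ) :
    EqOn (invXDeriv fun t => besselEntire n (μ * t ^ 2))
      (fun x => 2 * μ * besselEntire (n + 1) (μ * x ^ 2)) (Ioi 0) := by
  intro x hx
  have hx0 : x ≠ 0 := ne_of_gt hx
  have h := (hasDerivAt_besselEntire n (μ * x ^ 2)).comp x ((hasDerivAt_pow 2 x).const_mul μ)
  have h' : deriv (fun t => besselEntire n (μ * t ^ 2)) x = _ := h.deriv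
  simp only [invXDeriv, h']
  push_cast
  field_simp

theorem invXDeriv_iterate_besselEntire_sq (n k : ℕ) (μ : ℝ) :
    EqOn (invXDeriv^[k] fun t => besselEntire n (μ * t ^ 2))
      (fun x => (2 * μ) ^ k * besselEntire (n + k) (μ * x ^ 2)) (Ioi 0) := by
  induction k with
  | zero => intro x _; simp
  | succ k ih =>
    intro x hx
    rw [Function.iterate_succ_apply', invXDeriv_congr ih hx]
    have e := congrFun (invXDeriv_iterate_const_mul
      (fun t => besselEntire (n + k) (μ * t ^ 2)) ((2 * μ) ^ k) 1) x
    simp only [Function.iterate_one] at e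
    rw [e, invXDeriv_besselEntire_sq (n + k) μ hx, ← add_assoc]
    ring

theorem invXDeriv_pow_mul_besselEntire_sq (n : ℕ) (μ : ℝ) :
    EqOn (invXDeriv fun t => t ^ (2 * n + 2) * besselEntire (n + 1) (μ * t ^ 2))
      (fun x => 2 * (x ^ (2 * n) * besselEntire n (μ * x ^ 2))) (Ioi 0) := by
  intro x hx
  rw [invXDeriv_pow_mul ((contDiff_besselEntire_sq (n + 1) μ (m := 1)).differentiable
    (by simp) x) hx, invXDeriv_besselEntire_sq (n + 1) μ hx]
  simp only
  rw [besselEntire_recurrence n (μ * x ^ 2)]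
  ring

/-- The first n applications strip the weight and lower the index to 0, each giving a factor 2; the
other k raise the index, each giving 2μ. -/
theorem invXDeriv_iterate_pow_mul_besselEntire_sq (n k : ℕ) (μ : ℝ) :
    EqOn (invXDeriv^[n + k] fun t => t ^ (2 * n) * besselEntire n (μ * t ^ 2))
      (fun x => 2 ^ n * ((2 * μ) ^ k * besselEntire k (μ * x ^ 2))) (Ioi 0) := by
  induction n with
  | zero =>
    intro x hx
    simpa using invXDeriv_iterate_besselEntire_sq 0 k μ hx
  | succ n ih =>
    intro x hx
    rw [show n + 1 + k = n + k + 1 by ring, mul_add, mul_one, Function.iterate_succ_apply]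
    rw [invXDeriv_iterate_congr (invXDeriv_pow_mul_besselEntire_sq n μ) (n + k) hx,
      invXDeriv_iterate_const_mul]
    simp only [ih hx]
    ring

/-! ### The operators on combinations of two Bessel functions -/

theorem besselOpTwo_besselEntire_sq (α : ℕ) (μ A B : ℝ) {x : ℝ} (hx : 0 < x) :
    besselOpTwo α (fun t => A * besselEntire α (μ * t ^ 2) +
        B * (t ^ 2 * besselEntire (α + 2) (μ * t ^ 2))) x =
      4 * μ * (A * besselEntire α (μ * x ^ 2) + B * (x ^ 2 * besselEntire (α + 2) (μ * x ^ 2))) +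
        4 * B * (α + 1) * besselEntire (α + 2) (μ * x ^ 2) := by
  have cP : ∀ n, ContDiffOn ℝ ((2 : ℕ) : ℕ∞) (fun t => besselEntire n (μ * t ^ 2)) (Ioi 0) :=
    fun n => (contDiff_besselEntire_sq n μ).contDiffOn
  have cf : ContDiffOn ℝ ((2 : ℕ) : ℕ∞) (fun t => A * besselEntire α (μ * t ^ 2)) (Ioi 0) :=
    contDiffOn_const.mul (cP α)
  have cg : ContDiffOn ℝ ((2 : ℕ) : ℕ∞)
      (fun t => B * (t ^ 2 * besselEntire (α + 2) (μ * t ^ 2))) (Ioi 0) :=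
    contDiffOn_const.mul ((contDiffOn_id.pow 2).mul (cP (α + 2)))
  have e1 := invXDeriv_iterate_add (k := 1) (cf.of_le_nat one_le_two) (cg.of_le_nat one_le_two) hx
  have e2 := invXDeriv_iterate_add cf cg hx
  have s1 := invXDeriv_iterate_sq_mul (k := 0) ((cP (α + 2)).of_le_nat one_le_two) hx
  have s2 := invXDeriv_iterate_sq_mul (k := 1) (cP (α + 2)) hx
  rw [besselOpTwo_eq_invXDeriv α (cf.add cg) hx]
  change x ^ 2 * invXDeriv^[2] _ x + (2 * (α : ℝ) + 2) * invXDeriv^[1] _ x = _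
  rw [e1, e2]
  simp only [invXDeriv_iterate_const_mul]
  rw [s1, s2]
  simp only [zero_add, one_add_one_eq_two, invXDeriv_iterate_besselEntire_sq _ _ μ hx]
  have r0 := besselEntire_recurrence α (μ * x ^ 2)
  have r2 := besselEntire_recurrence (α + 2) (μ * x ^ 2)
  simp only [add_assoc, Nat.reduceAdd] at r0 r2 ⊢
  push_cast at r0 r2 ⊢
  simp only [pow_one, pow_zero, one_mul]
  linear_combination (-4 * μ * A) * r0 - 4 * B * μ * x ^ 2 * r2

theorem besselOpHigher_besselEntire_sq (α : ℕ) (μ A B : ℝ) {x : ℝ} (hx : 0 < x) :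
    besselOpHigher α (fun t => A * besselEntire α (μ * t ^ 2) +
        B * (t ^ 2 * besselEntire (α + 2) (μ * t ^ 2))) x =
      -(-4 * μ) ^ (α + 2) * (x ^ 2 * ((A * μ + B) * besselEntire (α + 2) (μ * x ^ 2) +
        A * (α + 1) * μ * besselEntire (α + 3) (μ * x ^ 2))) := by
  -- The recurrence for E_α leaves only products whose weight matches their index.
  have hsplit : (fun t : ℝ => t ^ (2 * α + 2) * (A * besselEntire α (μ * t ^ 2) +
        B * (t ^ 2 * besselEntire (α + 2) (μ * t ^ 2)))) =
      fun t => (A * μ + B) * (t ^ (2 * (α + 2)) * besselEntire (α + 2) (μ * t ^ 2)) +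
        A * (α + 1) * (t ^ (2 * (α + 1)) * besselEntire (α + 1) (μ * t ^ 2)) := by
    ext t
    rw [besselEntire_recurrence α (μ * t ^ 2)]
    ring
  have c : ∀ (C : ℝ) n, ContDiffOn ℝ ((2 * α + 4 : ℕ) : ℕ∞)
      (fun t => C * (t ^ (2 * n) * besselEntire n (μ * t ^ 2))) (Ioi 0) := fun C n =>
    contDiffOn_const.mul ((contDiffOn_id.pow _).mul (contDiff_besselEntire_sq n μ).contDiffOn)
  have d1 := invXDeriv_iterate_pow_mul_besselEntire_sq (α + 2) (α + 2) μ hx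
  have d2 := invXDeriv_iterate_pow_mul_besselEntire_sq (α + 1) (α + 3) μ hx
  rw [show α + 2 + (α + 2) = 2 * α + 4 by ring] at d1
  rw [show α + 1 + (α + 3) = 2 * α + 4 by ring] at d2
  rw [besselOpHigher, hsplit, invXDeriv_iterate_add (c _ _) (c _ _) hx]
  simp only [invXDeriv_iterate_const_mul]
  rw [d1, d2]
  have h4 : (-4 * μ) ^ (α + 2) = (-1) ^ (α + 2) * (2 ^ (α + 2) * (2 ^ (α + 2) * μ ^ (α + 2))) := by
    rw [← mul_pow, ← mul_pow, ← mul_pow]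
    ring
  rw [h4]
  simp only [mul_pow]
  ring

/-! ### Smoothness, limits at zero and the differential equations -/

theorem besselK_eq_besselEntire (α : ℕ) (lam x : ℝ) :
    besselK α lam x = -(besselCoeff α lam * Nat.factorial (α + 2)) *
      (x ^ 2 * besselEntire (α + 2) (-(1 / 4) * lam ^ 2 * x ^ 2)) := by
  rw [besselK, besselJ_eq_besselEntire]
  ring

theorem contDiff_besselEntire_sq_comb (α : ℕ) (μ A B : ℝ) :
    ContDiff ℝ ∞ fun t => A * besselEntire α (μ * t ^ 2) +
        B * (t ^ 2 * besselEntire (α + 2) (μ * t ^ 2)) :=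
  (contDiff_const.mul (contDiff_besselEntire_sq α μ)).add
    (contDiff_const.mul ((contDiff_id.pow 2).mul (contDiff_besselEntire_sq (α + 2) μ)))

/-- The right limit at zero of a function that agrees with a continuous one on `(0, ∞)`. -/
theorem tendsto_nhdsGT_zero_of_eqOn {f g : ℝ → ℝ} (h : ∀ x, 0 < x → f x = g x)
    (hg : Continuous g) : Tendsto f (𝓝[>] 0) (𝓝 (g 0)) :=
  ((hg.tendsto 0).mono_left nhdsWithin_le_nhds).congr' <| by
    filter_upwards [self_mem_nhdsWithin] with x hx using (h x hx).symm

theorem theorem5p1 (α : ℕ) :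
    -- the representations of the two operators on sufficiently smooth functions
    (∀ y : ℝ → ℝ, ContDiffOn ℝ 2 y (Ioi 0) → ∀ x : ℝ, 0 < x →
      besselOpTwo α y x = deriv (deriv y) x + (2 * (α : ℝ) + 1) / x * deriv y x) ∧
    (∀ y : ℝ → ℝ, ContDiffOn ℝ ((2 * α + 4 : ℕ) : ℕ∞) y (Ioi 0) → ∀ x : ℝ, 0 < x →
      besselOpHigher α y x = (-1) ^ (α + 1) * ((besselFactor α)^[α + 2] y) x) ∧
    -- the Bessel-type functions solve the combined equation on `[0, ∞)`;
    -- at `x = 0` the two differential expressions are understood as limits from the right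
    (∀ M lam : ℝ, 0 ≤ M → 0 ≤ lam →
      ContDiffOn ℝ ∞ (besselTypeJ α M lam) (Ici 0) ∧
      (∀ x : ℝ, 0 < x →
        (besselOpTwo α (besselTypeJ α M lam) x + lam ^ 2 * besselTypeJ α M lam x) +
          M / (2 ^ (2 * α + 2) * (Nat.factorial (α + 2) : ℝ)) *
            (besselOpHigher α (besselTypeJ α M lam) x +
              lam ^ (2 * α + 4) * besselTypeJ α M lam x) = 0) ∧
      (∃ u v : ℝ,
        Tendsto (besselOpTwo α (besselTypeJ α M lam)) (𝓝[>] 0) (𝓝 u) ∧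
        Tendsto (besselOpHigher α (besselTypeJ α M lam)) (𝓝[>] 0) (𝓝 v) ∧
        (u + lam ^ 2 * besselTypeJ α M lam 0) +
          M / (2 ^ (2 * α + 2) * (Nat.factorial (α + 2) : ℝ)) *
            (v + lam ^ (2 * α + 4) * besselTypeJ α M lam 0) = 0)) ∧
    -- the second component is an eigenfunction of the higher-order operator on `[0, ∞)`
    (∀ lam : ℝ, 0 ≤ lam →
      ContDiffOn ℝ ∞ (besselK α lam) (Ici 0) ∧
      (0 < lam → ∃ x : ℝ, 0 < x ∧ besselK α lam x ≠ 0) ∧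
      (∀ x : ℝ, 0 < x →
        besselOpHigher α (besselK α lam) x + lam ^ (2 * α + 4) * besselK α lam x = 0) ∧
      (∃ v : ℝ,
        Tendsto (besselOpHigher α (besselK α lam)) (𝓝[>] 0) (𝓝 v) ∧
        v + lam ^ (2 * α + 4) * besselK α lam 0 = 0)) := by
  refine ⟨fun y hy x hx => besselOpTwo_eq_deriv α hy hx,
    fun y hy x hx => besselOpHigher_eq_besselFactor α hy hx, fun M lam _ _ => ?_,
    fun lam _ => ?_⟩
  · set μ : ℝ := -(1 / 4) * lam ^ 2 with hμ
    set A : ℝ := (Nat.factorial α : ℝ) with hA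
    set B : ℝ := -(M * (besselCoeff α lam * Nat.factorial (α + 2))) with hB
    set y : ℝ → ℝ := fun t => A * besselEntire α (μ * t ^ 2) +
      B * (t ^ 2 * besselEntire (α + 2) (μ * t ^ 2)) with hy
    have hJ : besselTypeJ α M lam = y := by
      ext x
      rw [besselTypeJ, besselJ_eq_besselEntire, besselK_eq_besselEntire]
      simp only [hy, hB]
      ring
    have hsmooth : ContDiff ℝ ∞ y := contDiff_besselEntire_sq_comb α μ A B
    have hcont : ∀ n, Continuous fun x : ℝ => besselEntire n (μ * x ^ 2) := fun n =>
      (contDiff_besselEntire_sq n μ (m := 0)).continuous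
    set U : ℝ → ℝ := fun x => 4 * μ * y x + 4 * B * (α + 1) * besselEntire (α + 2) (μ * x ^ 2)
    set V : ℝ → ℝ := fun x => -(-4 * μ) ^ (α + 2) *
      (x ^ 2 * ((A * μ + B) * besselEntire (α + 2) (μ * x ^ 2) +
        A * (α + 1) * μ * besselEntire (α + 3) (μ * x ^ 2)))
    have hU : ∀ x, 0 < x → besselOpTwo α y x = U x := fun x hx =>
      besselOpTwo_besselEntire_sq α μ A B hx
    have hV : ∀ x, 0 < x → besselOpHigher α y x = V x := fun x hx =>
      besselOpHigher_besselEntire_sq α μ A B hx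
    have hUc : Continuous U :=
      (continuous_const.mul hsmooth.continuous).add (continuous_const.mul (hcont _))
    have hVc : Continuous V := continuous_const.mul <| (continuous_id.pow 2).mul <|
      (continuous_const.mul (hcont _)).add (continuous_const.mul (hcont _))
    have heq : ∀ x, (U x + lam ^ 2 * y x) + M / (2 ^ (2 * α + 2) * (Nat.factorial (α + 2) : ℝ)) *
        (V x + lam ^ (2 * α + 4) * y x) = 0 := by
      intro x
      have hl : lam ^ 2 = -4 * μ := by rw [hμ]; ring
      have hl' : lam ^ (2 * α + 4) = (-4 * μ) ^ (α + 2) := by rw [← hl, ← pow_mul]; ring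
      have r0 := besselEntire_recurrence α (μ * x ^ 2)
      have r1 := besselEntire_recurrence (α + 1) (μ * x ^ 2)
      simp only [add_assoc, Nat.reduceAdd] at r0 r1
      push_cast at r0 r1
      have h1 : U x + lam ^ 2 * y x = 4 * B * (α + 1) * besselEntire (α + 2) (μ * x ^ 2) := by
        simp only [U, hl]
        ring
      -- The B terms cancel; two uses of the recurrence collapse the A terms to E_{α+2}.
      have h2 : V x + lam ^ (2 * α + 4) * y x = lam ^ (2 * α + 4) *
          (A * (α + 1) * (α + 2) * besselEntire (α + 2) (μ * x ^ 2)) := by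
        simp only [V, hl', hy]
        linear_combination (-4 * μ) ^ (α + 2) * A * (r0 + (α + 1) * r1)
      have hfac : (Nat.factorial (α + 2) : ℝ) = (α + 2) * (α + 1) * A := by
        rw [Nat.factorial_succ, Nat.factorial_succ, hA]
        push_cast
        ring
      have hA0 : A ≠ 0 := by positivity
      -- Both coefficients of E_{α+2} are Mλ^{2α+4}/2^{2α+2} up to opposite signs.
      rw [h1, h2, hB, besselCoeff, hfac, div_pow, show 2 * α + 4 = 2 * α + 2 + 2 by ring,
        pow_add (2 : ℝ) (2 * α + 2) 2]
      field_simp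
      ring
    rw [hJ]
    exact ⟨hsmooth.contDiffOn, fun x hx => by rw [hU x hx, hV x hx, heq],
      U 0, V 0, tendsto_nhdsGT_zero_of_eqOn hU hUc, tendsto_nhdsGT_zero_of_eqOn hV hVc, heq 0⟩
  · set μ : ℝ := -(1 / 4) * lam ^ 2 with hμ
    set B : ℝ := -(besselCoeff α lam * Nat.factorial (α + 2)) with hB
    have hK : besselK α lam = fun t => 0 * besselEntire α (μ * t ^ 2) +
        B * (t ^ 2 * besselEntire (α + 2) (μ * t ^ 2)) := by
      ext x
      rw [besselK_eq_besselEntire, zero_mul, zero_add]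
    have hsmooth : ContDiff ℝ ∞ (besselK α lam) := hK ▸ contDiff_besselEntire_sq_comb α μ 0 B
    have hV : ∀ x, 0 < x →
        besselOpHigher α (besselK α lam) x = -lam ^ (2 * α + 4) * besselK α lam x := by
      intro x hx
      have hl : lam ^ (2 * α + 4) = (-4 * μ) ^ (α + 2) := by
        rw [show -4 * μ = lam ^ 2 by rw [hμ]; ring, ← pow_mul]
        ring
      rw [hK, besselOpHigher_besselEntire_sq α μ 0 B hx, hl]
      ring
    refine ⟨hsmooth.contDiffOn, fun hlam => ?_, fun x hx => by rw [hV x hx]; ring,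
      _, tendsto_nhdsGT_zero_of_eqOn hV (continuous_const.mul hsmooth.continuous), by ring⟩
    -- E_{α+2}(0) > 0, so by continuity K has no zeros just to the right of 0.
    have hpos : ∀ᶠ x in 𝓝[>] (0 : ℝ), 0 < besselEntire (α + 2) (μ * x ^ 2) := by
      have hc := (contDiff_besselEntire_sq (α + 2) μ (m := 0)).continuous.tendsto 0
      refine (hc.mono_left nhdsWithin_le_nhds).eventually_const_lt ?_
      simpa using besselEntire_zero_pos (α + 2)
    obtain ⟨x, hx, hx0⟩ := (hpos.and self_mem_nhdsWithin).exists
    have hx0' : x ≠ 0 := ne_of_gt hx0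
    have hB0 : B ≠ 0 := by
      rw [hB, besselCoeff, neg_ne_zero]
      positivity
    refine ⟨x, hx0, ?_⟩
    rw [hK]
    simp only [zero_mul, zero_add]
    exact mul_ne_zero hB0 (mul_ne_zero (pow_ne_zero 2 hx0') hx.ne')
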